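/- Let $n,m\in\mathbb N$, $g_1,\dots,g_m\in\mathbb R[\mathbf x]=\mathbb R[x_1,\dots,x_n]$, $g_{m+i}:=1-x_i^2$ for $i=1,\dots,n$, and $$\mathbf K:=\{\mathbf x\in\mathbb R^n:\ g_j(\mathbf x)\ge 0,\ j=1,\dots,m+n\}\ (\subseteq[-1,1]^n).$$ Assume that $\mathbf K$ has nonempty interior and $0\in\mathbf K$. Let $f\in\mathbb R[\mathbf x]$, $d_0:=\deg f$, let $\mathbb R[\mathbf x]_{d_0}$ be the space of polynomials of degree at most $d_0$ (identified, with its topology, with the finite-dimensional space of coefficient vectors), and let $k\in\{1,2,\infty\}$. For a polynomial $p=\sum_\alpha p_\alpha\mathbf x^\alpha$ put $\|p\|_1=\sum_\alpha|p_\alpha|$, $\|p\|_2=\sum_\alpha p_\alpha^2$, $\|p\|_\infty=\max_\alpha|p_\alpha|$. For $d\in\mathbb N$ let $Q_d(g)$ be the set of all $\sigma_0+\sum_{j=1}^{m+n}\sigma_jg_j$, where $\sigma_0$ is a sum of squares of polynomials with $\deg\sigma_0\le 2d$ and each $\sigma_j$ is a sum of squares of polynomials with $\deg\sigma_j\le 2(d-v_j)$,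 $v_j:=\lceil(\deg g_j)/2\rceil$ (here $\deg 0=-\infty$). For $\epsilon\ge0$ consider the problems $$\mathcal P_\epsilon:\ \min_{\tilde f\in\mathbb R[\mathbf x]_{d_0}}\{\|\tilde f-f\|_k:\ \tilde f(\mathbf x)-\tilde f(0)+\epsilon\ge0\ \text{ for all }\mathbf x\in\mathbf K\},$$ $$\mathbf P_{d,\epsilon}:\ \min_{\tilde f\in\mathbb R[\mathbf x]_{d_0}}\{\|\tilde f-f\|_k:\ \tilde f-\tilde f(0)+\epsilon\in Q_d(g)\}.$$ The ideal inverse problem is $\mathcal P:=\mathcal P_0$. (i) Let $\epsilon_\ell>0$, $\ell\in\mathbb N$, with $\epsilon_\ell\to0$, and for every $\ell$ let $\tilde f^*_{\epsilon_\ell}$ be any optimal solution of $\mathcal P_{\epsilon_\ell}$. Then every accumulation point $\hat f\in\mathbb R[\mathbf x]_{d_0}$ of the sequence $(\tilde f^*_{\epsilon_\ell})_\ell$ is an optimal solution of the ideal inverse problem $\mathcal P$. (ii) For every $\epsilon>0$ there is $D(\epsilon)\in\mathbb N$ (depending on $\epsilon$, $g$, $f$ and $k$) such that the following holds. Let $\epsilon_\ell>0$,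 $\ell\in\mathbb N$, with $\epsilon_\ell\to0$, let $d_\ell\in\mathbb N$ with $d_\ell\ge D(\epsilon_\ell)$ for all $\ell$, and for every $\ell$ let $\tilde f_{d_\ell\epsilon_\ell}$ be any optimal solution of $\mathbf P_{d_\ell,\epsilon_\ell}$. Then every accumulation point $\hat f\in\mathbb R[\mathbf x]_{d_0}$ of the sequence $(\tilde f_{d_\ell\epsilon_\ell})_\ell$ is an optimal solution of the ideal inverse problem $\mathcal P$. -/

import Mathlib

open MvPolynomial Filter Topology

namespace InversePoly

/-- The three admissible values `1`, `2`, `∞` of the index `k` of `‖·‖_k`. -/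
inductive NormIndex : Type
  | one : NormIndex
  | two : NormIndex
  | infty : NormIndex

/-- `‖p‖_k`, computed from the coefficients `p_α`: the sum of the `|p_α|` for `k = 1`, the sum of
the squares `p_α ^ 2` (no square root is taken) for `k = 2`, and the maximum of the `|p_α|` for
`k = ∞`. Only the finitely many nonzero coefficients contribute. -/
noncomputable def coeffNorm {n : ℕ} (k : NormIndex) (p : MvPolynomial (Fin n) ℝ) : ℝ :=
  match k with
  | NormIndex.one => ∑ α ∈ p.support, |p.coeff α|
  | NormIndex.two => ∑ α ∈ p.support, p.coeff α ^ 2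
  | NormIndex.infty => ((p.support.sup fun α => ‖p.coeff α‖₊ : NNReal) : ℝ)

/-- The constraint polynomials: the given `g_1, …, g_m`, followed by the `n` polynomials
`1 - x_i ^ 2`. -/
noncomputable def boxed {n m : ℕ} (g : Fin m → MvPolynomial (Fin n) ℝ) :
    Fin m ⊕ Fin n → MvPolynomial (Fin n) ℝ :=
  Sum.elim g fun i => 1 - X i ^ 2

/-- The basic closed semialgebraic set `{x ∈ ℝⁿ : g_j(x) ≥ 0 for all j}`. -/
def feasibleSet {n : ℕ} {ι : Type} (g : ι → MvPolynomial (Fin n) ℝ) : Set (Fin n → ℝ) :=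
  {x | ∀ j, 0 ≤ eval x (g j)}

/-- `Σ[x]_t`: the sums of squares of polynomials that have degree at most `2 t`. The zero polynomial
has degree `-∞`, so that it is the only element for `t < 0`. -/
def sosDegLE (n : ℕ) (t : ℤ) : Set (MvPolynomial (Fin n) ℝ) :=
  {s | IsSumSq s ∧ (s ≠ 0 → (s.totalDegree : ℤ) ≤ 2 * t)}

/-- `v(p) = ⌈deg p / 2⌉`. -/
noncomputable def halfDeg {n : ℕ} (p : MvPolynomial (Fin n) ℝ) : ℕ :=
  (p.totalDegree + 1) / 2

/-- `Q_d(g)`: the polynomials `σ_0 + ∑_j σ_j g_j` with `σ_0 ∈ Σ[x]_d` and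
`σ_j ∈ Σ[x]_{d - v_j}`, where `v_j = ⌈deg g_j / 2⌉`. -/
def truncQuadModule {n : ℕ} {ι : Type} [Fintype ι] (g : ι → MvPolynomial (Fin n) ℝ) (d : ℕ) :
    Set (MvPolynomial (Fin n) ℝ) :=
  {p | ∃ s₀ ∈ sosDegLE n (d : ℤ), ∃ s : ι → MvPolynomial (Fin n) ℝ,
    (∀ j, s j ∈ sosDegLE n ((d : ℤ) - (halfDeg (g j) : ℤ))) ∧ p = s₀ + ∑ j, s j * g j}

/-- `Psd_d(K)`: the polynomials of degree at most `d` that are nonnegative on `K`. -/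
def psdOn {n : ℕ} (d : ℕ) (K : Set (Fin n → ℝ)) : Set (MvPolynomial (Fin n) ℝ) :=
  {p | p ∈ restrictTotalDegree (Fin n) ℝ d ∧ ∀ x ∈ K, 0 ≤ eval x p}

/-- The feasible solutions of the ideal `ε`-problem at the point `y`: the polynomials `h` of degree
at most `d₀` with `h - h(y) + ε ∈ Psd_{d₀}(K)`. The ideal inverse problem is the case `ε = 0`. -/
def idealFeasible {n : ℕ} (K : Set (Fin n → ℝ)) (d₀ : ℕ) (y : Fin n → ℝ) (ε : ℝ) :
    Set (MvPolynomial (Fin n) ℝ) :=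
  {h | h ∈ restrictTotalDegree (Fin n) ℝ d₀ ∧ h - C (eval y h) + C ε ∈ psdOn d₀ K}

/-- The feasible solutions of the practical `ε`-problem with degree bound `d`, at the point `0`: the
polynomials `h` of degree at most `d₀` with `h - h(0) + ε ∈ Q_d(g)`. -/
def practicalFeasible {n : ℕ} {ι : Type} [Fintype ι] (g : ι → MvPolynomial (Fin n) ℝ)
    (d₀ d : ℕ) (ε : ℝ) : Set (MvPolynomial (Fin n) ℝ) :=
  {h | h ∈ restrictTotalDegree (Fin n) ℝ d₀ ∧ h - C (eval 0 h) + C ε ∈ truncQuadModule g d}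

/-- `h` is an optimal solution of the problem of minimizing `‖h - f‖_k` over `h ∈ S`. -/
def IsNearest {n : ℕ} (k : NormIndex) (f : MvPolynomial (Fin n) ℝ)
    (S : Set (MvPolynomial (Fin n) ℝ)) (h : MvPolynomial (Fin n) ℝ) : Prop :=
  h ∈ S ∧ ∀ p ∈ S, coeffNorm k (h - f) ≤ coeffNorm k (p - f)

/-- Optimal solutions of the ideal inverse `ε`-problem for the criterion `f`, with `d₀ = deg f`. -/
def IsIdealOptimal {n : ℕ} (k : NormIndex) (K : Set (Fin n → ℝ)) (f : MvPolynomial (Fin n) ℝ)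
    (y : Fin n → ℝ) (ε : ℝ) (h : MvPolynomial (Fin n) ℝ) : Prop :=
  IsNearest k f (idealFeasible K f.totalDegree y ε) h

/-- Optimal solutions of the practical inverse `ε`-problem with degree bound `d` for the
criterion `f`, with `d₀ = deg f`. -/
def IsPracticalOptimal {n : ℕ} {ι : Type} [Fintype ι] (k : NormIndex)
    (g : ι → MvPolynomial (Fin n) ℝ) (f : MvPolynomial (Fin n) ℝ) (d : ℕ) (ε : ℝ)
    (h : MvPolynomial (Fin n) ℝ) : Prop :=
  IsNearest k f (practicalFeasible g f.totalDegree d ε) h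

/-- The vector of the coefficients `p_α`, `|α| ≤ d`, which identifies `ℝ[x]_d` with a
finite-dimensional coordinate space. -/
def coeffVec {n : ℕ} (d : ℕ) (p : MvPolynomial (Fin n) ℝ) :
    {α : Fin n →₀ ℕ // α.degree ≤ d} → ℝ :=
  fun α => p.coeff α.1

/-- `h ∈ ℝ[x]_d` is an accumulation point of the sequence `u` of elements of `ℝ[x]_d`, for the
topology of the finite-dimensional space of coefficient vectors. -/
def IsAccPt {n : ℕ} (d : ℕ) (u : ℕ → MvPolynomial (Fin n) ℝ) (h : MvPolynomial (Fin n) ℝ) :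
    Prop :=
  h ∈ restrictTotalDegree (Fin n) ℝ d ∧
    MapClusterPt (coeffVec d h) atTop fun l => coeffVec d (u l)

end InversePoly

/-! Norms and point evaluations are continuous in the coefficients. Along a convergent subsequence
the relaxed constraint therefore passes to the limit, and so does `‖u l - f‖ ≤ ‖p - f‖ + δ l` for
each ideal competitor `p`, provided `δ l → 0` (`isIdealOptimal_of_isAccPt`). In (i) `δ = 0` works,
since ideal competitors stay feasible for every `ε > 0`. In (ii) fix an ideal competitor `p` optimal
up to `ε`: then `p - p(0) + ε` is positive on `K`, so by Putinar it lies in `Q_d(g)` for all large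
`d`. This defines `D(ε)` and gives `δ = ε` (`exists_degree_bound`). Putinar's theorem is proved
algebraically: a maximal proper Archimedean quadratic module is total and determines a real point
(`exists_eval_nonneg`). Adjoining `-p` either produces a point contradicting `p > 0` or gives `s * p
- 1 ∈ M`, whence `p ∈ M` by a descent (`mem_of_sumSq_mul_sub_one_mem`). -/

namespace InversePoly

/-! ### Quadratic modules: maximality, real values, descent -/

section QuadraticModule

variable {A : Type*} [CommRing A]

/-- Quadratic modules of a commutative ring. -/
structure IsQuadraticModule (M : Set A) : Prop where
  one_mem : (1 : A) ∈ M
  add_mem : ∀ {a b : A}, a ∈ M → b ∈ M → a + b ∈ M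
  sq_mul_mem : ∀ (a : A) {b : A}, b ∈ M → a ^ 2 * b ∈ M

namespace IsQuadraticModule

variable {M : Set A}

theorem zero_mem (hM : IsQuadraticModule M) : (0 : A) ∈ M := by
  simpa using hM.sq_mul_mem 0 hM.one_mem

theorem sumSq_mul_mem (hM : IsQuadraticModule M) {s b : A} (hs : IsSumSq s) (hb : b ∈ M) :
    s * b ∈ M := by
  induction hs with
  | zero => simpa using hM.zero_mem
  | sq_add a _ ih =>
    have := hM.add_mem (hM.sq_mul_mem a hb) ih
    convert this using 1
    ring

theorem sumSq_mem (hM : IsQuadraticModule M) {s : A} (hs : IsSumSq s) : s ∈ M := by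
  simpa using hM.sumSq_mul_mem hs hM.one_mem

theorem adjoin (hM : IsQuadraticModule M) (a : A) :
    IsQuadraticModule {x : A | ∃ b ∈ M, ∃ s, IsSumSq s ∧ x = b + s * a} where
  one_mem := ⟨1, hM.one_mem, 0, .zero, by simp⟩
  add_mem := by
    rintro _ _ ⟨b, hb, s, hs, rfl⟩ ⟨c, hc, t, ht, rfl⟩
    exact ⟨b + c, hM.add_mem hb hc, s + t, hs.add ht, by ring⟩
  sq_mul_mem := by
    rintro y _ ⟨b, hb, s, hs, rfl⟩
    refine ⟨y ^ 2 * b, hM.sq_mul_mem y hb, y * y * s, (IsSumSq.mul_self y).mul hs, by ring⟩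

theorem exists_maximal (hM : IsQuadraticModule M) (h1 : (-1 : A) ∉ M) :
    ∃ S, M ⊆ S ∧ Maximal (fun S : Set A => IsQuadraticModule S ∧ (-1 : A) ∉ S) S := by
  refine zorn_subset_nonempty {S : Set A | IsQuadraticModule S ∧ (-1 : A) ∉ S} ?_ M ⟨hM, h1⟩
  intro c hc hchain hne
  refine ⟨⋃₀ c, ⟨⟨?_, ?_, ?_⟩, ?_⟩, fun s hs => Set.subset_sUnion_of_mem hs⟩
  · obtain ⟨s, hs⟩ := hne
    exact ⟨s, hs, (hc hs).1.one_mem⟩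
  · rintro a b ⟨s, hs, has⟩ ⟨t, ht, hbt⟩
    rcases hchain.total hs ht with h | h
    · exact ⟨t, ht, (hc ht).1.add_mem (h has) hbt⟩
    · exact ⟨s, hs, (hc hs).1.add_mem has (h hbt)⟩
  · rintro a b ⟨s, hs, hbs⟩
    exact ⟨s, hs, (hc hs).1.sq_mul_mem a hbs⟩
  · rintro ⟨s, hs, h⟩
    exact (hc hs).2 h

theorem neg_one_mem_adjoin_of_maximal {S : Set A}
    (hS : Maximal (fun S : Set A => IsQuadraticModule S ∧ (-1 : A) ∉ S) S) {a : A} (ha : a ∉ S) :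
    ∃ b ∈ S, ∃ s, IsSumSq s ∧ (-1 : A) = b + s * a := by
  by_contra h
  refine ha (hS.2 ⟨hS.1.1.adjoin a, h⟩ ?_ ⟨0, hS.1.1.zero_mem, 1, .one, by simp⟩)
  exact fun x hx => ⟨x, hx, 0, .zero, by simp⟩

end IsQuadraticModule

variable [Algebra ℝ A]

/-- A set `M` is Archimedean if every element is bounded above by a real constant modulo `M`. -/
def IsArchimedeanSet (M : Set A) : Prop :=
  ∀ a : A, ∃ N : ℝ, algebraMap ℝ A N - a ∈ M

namespace IsQuadraticModule

variable {M : Set A}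

theorem const_mul_mem (hM : IsQuadraticModule M) {c : ℝ} (hc : 0 ≤ c) {b : A} (hb : b ∈ M) :
    algebraMap ℝ A c * b ∈ M := by
  have := hM.sq_mul_mem (algebraMap ℝ A (Real.sqrt c)) hb
  rwa [← map_pow, Real.sq_sqrt hc] at this

theorem const_mem (hM : IsQuadraticModule M) {c : ℝ} (hc : 0 ≤ c) : algebraMap ℝ A c ∈ M := by
  simpa using hM.const_mul_mem hc hM.one_mem

theorem mem_of_const_mul_mem (hM : IsQuadraticModule M) {c : ℝ} (hc : 0 < c) {b : A}
    (hb : algebraMap ℝ A c * b ∈ M) : b ∈ M := by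
  have := hM.const_mul_mem (inv_nonneg.2 hc.le) hb
  rwa [← mul_assoc, ← map_mul, inv_mul_cancel₀ hc.ne', map_one, one_mul] at this

theorem const_nonneg (hM : IsQuadraticModule M) (h1 : (-1 : A) ∉ M) {c : ℝ}
    (hc : algebraMap ℝ A c ∈ M) : 0 ≤ c := by
  by_contra! h
  refine h1 (hM.mem_of_const_mul_mem (neg_pos.2 h) ?_)
  simpa using hc

/-- `2c(c² - a²) = (c - a)²(c + a) + (c + a)²(c - a)`. -/
theorem sq_sub_sq_mem (hM : IsQuadraticModule M) {c : ℝ} (hc : 0 < c) {a : A}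
    (h₁ : algebraMap ℝ A c - a ∈ M) (h₂ : algebraMap ℝ A c + a ∈ M) :
    algebraMap ℝ A (c ^ 2) - a ^ 2 ∈ M := by
  refine hM.mem_of_const_mul_mem (c := 2 * c) (by positivity) ?_
  have := hM.add_mem (hM.sq_mul_mem (algebraMap ℝ A c - a) h₂)
    (hM.sq_mul_mem (algebraMap ℝ A c + a) h₁)
  convert this using 1
  simp only [map_mul, map_pow, map_ofNat]
  ring

/-- `M ∩ -M` is an ideal, because `4ax = (a + 1)²x + (a - 1)²(-x)`. -/
theorem mul_mem_of_mem_of_neg_mem (hM : IsQuadraticModule M) {x : A} (h₁ : x ∈ M) (h₂ : -x ∈ M)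
    (a : A) : a * x ∈ M := by
  refine hM.mem_of_const_mul_mem (c := 4) (by positivity) ?_
  have := hM.add_mem (hM.sq_mul_mem (a + 1) h₁) (hM.sq_mul_mem (a - 1) h₂)
  convert this using 1
  simp only [map_ofNat]
  ring

theorem mem_or_neg_mem_of_maximal {S : Set A}
    (hS : Maximal (fun S : Set A => IsQuadraticModule S ∧ (-1 : A) ∉ S) S) (a : A) :
    a ∈ S ∨ -a ∈ S := by
  by_contra! h
  have hQ := hS.1.1
  obtain ⟨b, hb, s, hs, h₁⟩ := neg_one_mem_adjoin_of_maximal hS h.1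
  obtain ⟨c, hc, t, ht, h₂⟩ := neg_one_mem_adjoin_of_maximal hS h.2
  -- Eliminating `a` from `-1 = b + s a` and `-1 = c - t a` gives `-t = s + t b + s c`.
  have hneg : -t ∈ S := by
    have := hQ.add_mem (hQ.add_mem (hQ.sumSq_mem hs) (hQ.sumSq_mul_mem ht hb))
      (hQ.sumSq_mul_mem hs hc)
    convert this using 1
    linear_combination t * h₁ + s * h₂
  have hta : -a * t ∈ S := hQ.mul_mem_of_mem_of_neg_mem (hQ.sumSq_mem ht) hneg (-a)
  refine hS.1.2 ?_
  rw [h₂, mul_comm t]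
  exact hQ.add_mem hc hta

end IsQuadraticModule

/-- `a` lies infinitely close to the real constant `r` with respect to `S`. -/
def IsInfinitelyClose (S : Set A) (a : A) (r : ℝ) : Prop :=
  ∀ ε : ℝ, 0 < ε → algebraMap ℝ A (r + ε) - a ∈ S ∧ a - algebraMap ℝ A (r - ε) ∈ S

namespace IsInfinitelyClose

variable {S : Set A} {a b : A} {r s : ℝ}

theorem const (hS : IsQuadraticModule S) (r : ℝ) :
    IsInfinitelyClose S (algebraMap ℝ A r) r := by
  intro ε hε
  rw [← map_sub, ← map_sub]
  exact ⟨hS.const_mem (by linarith), hS.const_mem (by linarith)⟩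

theorem add (hS : IsQuadraticModule S) (ha : IsInfinitelyClose S a r)
    (hb : IsInfinitelyClose S b s) : IsInfinitelyClose S (a + b) (r + s) := by
  intro ε hε
  obtain ⟨h₁, h₂⟩ := ha (ε / 2) (by positivity)
  obtain ⟨h₃, h₄⟩ := hb (ε / 2) (by positivity)
  constructor
  · convert hS.add_mem h₁ h₃ using 1
    rw [show r + s + ε = (r + ε / 2) + (s + ε / 2) by ring, map_add]
    ring
  · convert hS.add_mem h₂ h₄ using 1
    rw [show r + s - ε = (r - ε / 2) + (s - ε / 2) by ring, map_add]
    ring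

theorem neg (ha : IsInfinitelyClose S a r) : IsInfinitelyClose S (-a) (-r) := by
  intro ε hε
  obtain ⟨h₁, h₂⟩ := ha ε hε
  constructor
  · convert h₂ using 1
    rw [show -r + ε = -(r - ε) by ring, map_neg]
    ring
  · convert h₁ using 1
    rw [show -r - ε = -(r + ε) by ring, map_neg]
    ring

theorem const_mul_of_pos (hS : IsQuadraticModule S) (ha : IsInfinitelyClose S a r) {c : ℝ}
    (hc : 0 < c) : IsInfinitelyClose S (algebraMap ℝ A c * a) (c * r) := by
  intro ε hε
  obtain ⟨h₁, h₂⟩ := ha (ε / c) (by positivity)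
  constructor
  · convert hS.const_mul_mem hc.le h₁ using 1
    rw [mul_sub, ← map_mul, mul_add, mul_div_cancel₀ _ hc.ne']
  · convert hS.const_mul_mem hc.le h₂ using 1
    rw [mul_sub, ← map_mul, mul_sub, mul_div_cancel₀ _ hc.ne']

theorem const_mul (hS : IsQuadraticModule S) (ha : IsInfinitelyClose S a r) (c : ℝ) :
    IsInfinitelyClose S (algebraMap ℝ A c * a) (c * r) := by
  rcases lt_trichotomy c 0 with hc | rfl | hc
  · simpa using (ha.const_mul_of_pos hS (neg_pos.2 hc)).neg
  · simpa using const hS 0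
  · exact ha.const_mul_of_pos hS hc

theorem sq_zero (hS : IsQuadraticModule S) (ha : IsInfinitelyClose S a 0) :
    IsInfinitelyClose S (a ^ 2) 0 := by
  intro ε hε
  constructor
  · obtain ⟨h₁, h₂⟩ := ha (Real.sqrt ε) (Real.sqrt_pos.2 hε)
    have := hS.sq_sub_sq_mem (Real.sqrt_pos.2 hε) (a := a) (by simpa using h₁)
      (by simpa [add_comm] using h₂)
    rwa [Real.sq_sqrt hε.le, ← zero_add ε] at this
  · have := hS.add_mem (hS.sq_mul_mem a hS.one_mem) (hS.const_mem hε.le)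
    simpa using this

theorem sq (hS : IsQuadraticModule S) (ha : IsInfinitelyClose S a r) :
    IsInfinitelyClose S (a ^ 2) (r ^ 2) := by
  have h₀ : IsInfinitelyClose S (a + algebraMap ℝ A (-r)) 0 := by
    simpa using ha.add hS (const hS (-r))
  convert ((h₀.sq_zero hS).add hS (ha.const_mul hS (2 * r))).add hS (const hS (-r ^ 2)) using 1
  · simp only [map_mul, map_neg, map_pow, map_ofNat]
    ring
  · ring

/-- Polarization reduces products to squares: `2ab = (a + b)² - a² - b²`. -/
theorem mul (hS : IsQuadraticModule S) (ha : IsInfinitelyClose S a r)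
    (hb : IsInfinitelyClose S b s) : IsInfinitelyClose S (a * b) (r * s) := by
  convert ((((ha.add hS hb).sq hS).add hS (ha.sq hS).neg).add hS (hb.sq hS).neg).const_mul hS
    (1 / 2) using 1
  · have h : algebraMap ℝ A (1 / 2) * 2 = 1 := by
      rw [← map_ofNat (algebraMap ℝ A) 2, ← map_mul]
      norm_num
    linear_combination -(a * b) * h
  · ring

theorem nonneg (hS : IsQuadraticModule S) (h1 : (-1 : A) ∉ S) (ha : IsInfinitelyClose S a r)
    (h : a ∈ S) : 0 ≤ r := by
  refine le_of_forall_pos_le_add fun ε hε => ?_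
  refine hS.const_nonneg h1 ?_
  simpa using hS.add_mem (ha ε hε).1 h

theorem exists_of_total (hS : IsQuadraticModule S) (h1 : (-1 : A) ∉ S)
    (hA : IsArchimedeanSet S) (htot : ∀ a, a ∈ S ∨ -a ∈ S) (a : A) :
    ∃ r, IsInfinitelyClose S a r := by
  -- Dedekind cut: the value of `a` is the infimum of its upper bounds modulo `S`; totality supplies
  -- the lower estimate.
  set B : Set ℝ := {r | algebraMap ℝ A r - a ∈ S}
  have hne : B.Nonempty := hA a
  have hbdd : BddBelow B := by
    obtain ⟨N, hN⟩ := hA (-a)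
    refine ⟨-N, fun r hr => ?_⟩
    have := hS.const_nonneg h1 (c := N + r) (by
      convert hS.add_mem hN hr using 1
      rw [map_add]
      ring)
    linarith
  refine ⟨sInf B, fun ε hε => ⟨?_, ?_⟩⟩
  · obtain ⟨r, hr, hlt⟩ := exists_lt_of_csInf_lt hne (lt_add_of_pos_right (sInf B) hε)
    convert hS.add_mem hr (hS.const_mem (sub_nonneg.2 hlt.le)) using 1
    rw [map_sub]
    ring
  · rcases htot (algebraMap ℝ A (sInf B - ε) - a) with h | h
    · linarith [csInf_le hbdd h]
    · simpa using h

end IsInfinitelyClose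

theorem IsArchimedeanSet.mono {M S : Set A} (hM : IsArchimedeanSet M) (h : M ⊆ S) :
    IsArchimedeanSet S :=
  fun a => (hM a).imp fun _ hN => h hN

/-- Descent: a constant `r ≥ 0` with `p + r ∈ M` can be lowered by the fixed amount `1/k²`, so
finitely many steps reach `r = 0`. -/
theorem IsQuadraticModule.mem_of_sumSq_mul_sub_one_mem {M : Set A} (hM : IsQuadraticModule M)
    (hA : IsArchimedeanSet M) {p s : A} (hs : IsSumSq s) (hp : s * p - 1 ∈ M) : p ∈ M := by
  obtain ⟨k, hk0, hk1, hk2⟩ : ∃ k : ℝ, 0 < k ∧ algebraMap ℝ A (2 * k) - s ∈ M ∧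
      algebraMap ℝ A (2 * k - 1) - s ^ 2 * p ∈ M := by
    obtain ⟨N₁, h₁⟩ := hA s
    obtain ⟨N₂, h₂⟩ := hA (s ^ 2 * p)
    have e₁ := le_abs_self N₁
    have e₂ := le_abs_self N₂
    have e₃ := abs_nonneg N₁
    have e₄ := abs_nonneg N₂
    refine ⟨|N₁| + |N₂| + 1, by positivity, ?_, ?_⟩
    · convert hM.add_mem h₁ (hM.const_mem (c := 2 * (|N₁| + |N₂| + 1) - N₁) (by linarith)) using 1
      rw [map_sub]
      ring
    · convert hM.add_mem h₂ (hM.const_mem (c := 2 * (|N₁| + |N₂| + 1) - 1 - N₂) (by linarith))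
        using 1
      rw [map_sub _ _ N₂]
      ring
  have hss : s * (algebraMap ℝ A (2 * k) - s) ∈ M := by
    refine hM.mem_of_const_mul_mem (c := 2 * k) (by positivity) ?_
    convert hM.add_mem (hM.sq_mul_mem (algebraMap ℝ A (2 * k) - s) (hM.sumSq_mem hs))
      (hM.sq_mul_mem s hk1) using 1
    ring
  have step : ∀ r : ℝ, 0 ≤ r → p + algebraMap ℝ A r ∈ M →
      p + algebraMap ℝ A (r - (k ^ 2)⁻¹) ∈ M := by
    intro r hr h
    refine hM.mem_of_const_mul_mem (c := k ^ 2) (by positivity) ?_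
    -- `k²(p + r) - 1 = (k - s)²(p + r) + 2k(s p - 1) + r s(2k - s) + (2k - 1 - s²p)`.
    have hmem := hM.add_mem (hM.add_mem (hM.add_mem (hM.sq_mul_mem (algebraMap ℝ A k - s) h)
      (hM.const_mul_mem (c := 2 * k) (by positivity) hp)) (hM.const_mul_mem hr hss)) hk2
    have hk : algebraMap ℝ A (k ^ 2) * algebraMap ℝ A (k ^ 2)⁻¹ = 1 := by
      rw [← map_mul, mul_inv_cancel₀ (by positivity), map_one]
    convert hmem using 1
    rw [map_sub _ r, mul_add, mul_sub, hk]
    simp only [map_sub, map_mul, map_pow, map_one, map_ofNat]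
    ring
  obtain ⟨N, hN⟩ := hA (-p)
  -- The maximum with `0` keeps the constant nonnegative, as `step` requires.
  have hiter : ∀ j : ℕ, p + algebraMap ℝ A (max (N - j * (k ^ 2)⁻¹) 0) ∈ M := by
    intro j
    induction j with
    | zero =>
      convert hM.add_mem hN (hM.const_mem (c := max N 0 - N) (by simp)) using 1
      rw [map_sub, Nat.cast_zero, zero_mul, sub_zero]
      ring
    | succ j ih =>
      have hle : max (N - j * (k ^ 2)⁻¹) 0 - (k ^ 2)⁻¹ ≤ max (N - (j + 1 : ℕ) * (k ^ 2)⁻¹) 0 := by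
        have : 0 < (k ^ 2)⁻¹ := by positivity
        rw [sub_le_iff_le_add]
        refine max_le ?_ (by positivity)
        have := le_max_left (N - (j + 1 : ℕ) * (k ^ 2)⁻¹) 0
        push_cast at this ⊢
        linarith
      convert hM.add_mem (step _ (le_max_right _ _) ih) (hM.const_mem (sub_nonneg.2 hle)) using 1
      rw [map_sub (algebraMap ℝ A) (max (N - (j + 1 : ℕ) * (k ^ 2)⁻¹) 0)]
      ring
  obtain ⟨j, hj⟩ := exists_nat_ge (N * k ^ 2)
  have hj0 : N - j * (k ^ 2)⁻¹ ≤ 0 := by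
    rw [sub_nonpos, ← div_eq_mul_inv, le_div_iff₀ (by positivity)]
    exact hj
  simpa [max_eq_right hj0] using hiter j

end QuadraticModule

/-! ### Putinar's Positivstellensatz and truncated quadratic modules -/

section Putinar

variable {n : ℕ}

/-- A proper Archimedean quadratic module is nonnegative at some real point. -/
theorem IsQuadraticModule.exists_eval_nonneg {M : Set (MvPolynomial (Fin n) ℝ)}
    (hM : IsQuadraticModule M) (hA : IsArchimedeanSet M) (h1 : -1 ∉ M) :
    ∃ x : Fin n → ℝ, ∀ p ∈ M, 0 ≤ eval x p := by
  obtain ⟨S, hMS, hS⟩ := hM.exists_maximal h1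
  have hQ := hS.1.1
  choose x hx using fun i : Fin n => IsInfinitelyClose.exists_of_total hQ hS.1.2 (hA.mono hMS)
    (IsQuadraticModule.mem_or_neg_mem_of_maximal hS) (X i)
  -- Closeness respects ring operations, so the values of the coordinates determine those of all
  -- polynomials.
  have key : ∀ p : MvPolynomial (Fin n) ℝ, IsInfinitelyClose S p (eval x p) := by
    intro p
    induction p using MvPolynomial.induction_on with
    | C r => simpa [MvPolynomial.algebraMap_eq] using IsInfinitelyClose.const hQ r
    | add p q hp hq => simpa using hp.add hQ hq
    | mul_X p i hp => simpa using hp.mul hQ (hx i)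
  exact ⟨x, fun p hp => (key p).nonneg hQ hS.1.2 (hMS hp)⟩

/-- **Putinar's Positivstellensatz** for an Archimedean quadratic module of real polynomials. -/
theorem IsQuadraticModule.mem_of_pos {M : Set (MvPolynomial (Fin n) ℝ)}
    (hM : IsQuadraticModule M) (hA : IsArchimedeanSet M) {p : MvPolynomial (Fin n) ℝ}
    (hp : ∀ x : Fin n → ℝ, (∀ q ∈ M, 0 ≤ eval x q) → 0 < eval x p) : p ∈ M := by
  have hsub : M ⊆ {x | ∃ b ∈ M, ∃ s, IsSumSq s ∧ x = b + s * -p} :=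
    fun x hx => ⟨x, hx, 0, .zero, by simp⟩
  by_cases h : -1 ∈ {x | ∃ b ∈ M, ∃ s, IsSumSq s ∧ x = b + s * -p}
  · obtain ⟨b, hb, s, hs, h⟩ := h
    refine hM.mem_of_sumSq_mul_sub_one_mem hA hs ?_
    convert hb using 1
    linear_combination h
  · obtain ⟨x, hx⟩ := (hM.adjoin (-p)).exists_eval_nonneg (hA.mono hsub) h
    have h₁ := hp x fun q hq => hx q (hsub hq)
    have h₂ := hx (-p) ⟨0, hM.zero_mem, 1, .one, by simp⟩
    rw [map_neg] at h₂
    linarith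

/-- An Archimedean quadratic module is one that bounds the coordinates. -/
theorem IsQuadraticModule.isArchimedeanSet {M : Set (MvPolynomial (Fin n) ℝ)}
    (hM : IsQuadraticModule M) (hX : ∀ i, 1 - X i ^ 2 ∈ M) : IsArchimedeanSet M := by
  suffices h : ∀ p : MvPolynomial (Fin n) ℝ, ∃ N : ℝ, 0 < N ∧ C N - p ∈ M ∧ C N + p ∈ M from
    fun p => (h p).imp fun N hN => hN.2.1
  intro p
  induction p using MvPolynomial.induction_on with
  | C r =>
    refine ⟨|r| + 1, by positivity, ?_, ?_⟩
    · rw [← C_sub]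
      exact hM.const_mem (by linarith [le_abs_self r])
    · rw [← C_add]
      exact hM.const_mem (by linarith [neg_abs_le r])
  | add p q hp hq =>
    obtain ⟨N, hN, h₁, h₂⟩ := hp
    obtain ⟨N', hN', h₃, h₄⟩ := hq
    refine ⟨N + N', by positivity, ?_, ?_⟩
    · convert hM.add_mem h₁ h₃ using 1
      rw [C_add]
      ring
    · convert hM.add_mem h₂ h₄ using 1
      rw [C_add]
      ring
  | mul_X p i hp =>
    obtain ⟨N, hN, h₁, h₂⟩ := hp
    have hsq := hM.sq_sub_sq_mem hN h₁ h₂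
    rw [MvPolynomial.algebraMap_eq] at hsq
    -- `2(N² + 1 ∓ p X) = (N² - p²) + (1 - X²) + (p ∓ X)² + (N² + 1)`.
    refine ⟨N ^ 2 + 1, by positivity, ?_, ?_⟩
    · refine hM.mem_of_const_mul_mem (c := 2) (by positivity) ?_
      convert hM.add_mem (hM.add_mem (hM.add_mem hsq (hX i))
        (hM.sq_mul_mem (p - X i) hM.one_mem)) (hM.const_mem (c := N ^ 2 + 1) (by positivity)) using 1
      simp only [MvPolynomial.algebraMap_eq, C_add, C_1, map_ofNat]
      ring
    · refine hM.mem_of_const_mul_mem (c := 2) (by positivity) ?_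
      convert hM.add_mem (hM.add_mem (hM.add_mem hsq (hX i))
        (hM.sq_mul_mem (p + X i) hM.one_mem)) (hM.const_mem (c := N ^ 2 + 1) (by positivity)) using 1
      simp only [MvPolynomial.algebraMap_eq, C_add, C_1, map_ofNat]
      ring

variable {ι : Type} [Fintype ι]

/-- The quadratic module generated by a finite family of polynomials. -/
def quadModule (g : ι → MvPolynomial (Fin n) ℝ) : Set (MvPolynomial (Fin n) ℝ) :=
  {p | ∃ s₀, IsSumSq s₀ ∧ ∃ s : ι → MvPolynomial (Fin n) ℝ,
    (∀ j, IsSumSq (s j)) ∧ p = s₀ + ∑ j, s j * g j}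

theorem isQuadraticModule_quadModule (g : ι → MvPolynomial (Fin n) ℝ) :
    IsQuadraticModule (quadModule g) where
  one_mem := ⟨1, .one, 0, fun _ => .zero, by simp⟩
  add_mem := by
    rintro _ _ ⟨s₀, hs₀, s, hs, rfl⟩ ⟨t₀, ht₀, t, ht, rfl⟩
    refine ⟨s₀ + t₀, hs₀.add ht₀, s + t, fun j => (hs j).add (ht j), ?_⟩
    simp only [Pi.add_apply, add_mul, Finset.sum_add_distrib]
    ring
  sq_mul_mem := by
    rintro a _ ⟨s₀, hs₀, s, hs, rfl⟩
    refine ⟨a * a * s₀, (IsSumSq.mul_self a).mul hs₀, fun j => a * a * s j,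
      fun j => (IsSumSq.mul_self a).mul (hs j), ?_⟩
    rw [mul_add, Finset.mul_sum, sq]
    simp only [mul_assoc]

theorem generator_mem_quadModule (g : ι → MvPolynomial (Fin n) ℝ) (j : ι) :
    g j ∈ quadModule g := by
  classical
  refine ⟨0, .zero, Pi.single j 1, fun i => ?_, ?_⟩
  · by_cases h : i = j
    · subst h
      simp
    · simp [h]
  · simp [Pi.single_apply]

theorem eval_nonneg_of_isSumSq {s : MvPolynomial (Fin n) ℝ} (hs : IsSumSq s) (x : Fin n → ℝ) :
    0 ≤ eval x s := by
  induction hs with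
  | zero => simp
  | sq_add a _ ih =>
    rw [map_add, map_mul]
    exact add_nonneg (mul_self_nonneg _) ih

theorem eval_nonneg_of_mem_truncQuadModule {g : ι → MvPolynomial (Fin n) ℝ} {d : ℕ}
    {p : MvPolynomial (Fin n) ℝ} (hp : p ∈ truncQuadModule g d) {x : Fin n → ℝ}
    (hx : x ∈ feasibleSet g) : 0 ≤ eval x p := by
  obtain ⟨s₀, hs₀, s, hs, rfl⟩ := hp
  rw [map_add, map_sum]
  refine add_nonneg (eval_nonneg_of_isSumSq hs₀.1 x) (Finset.sum_nonneg fun j _ => ?_)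
  rw [map_mul]
  exact mul_nonneg (eval_nonneg_of_isSumSq (hs j).1 x) (hx j)

theorem exists_mem_truncQuadModule {g : ι → MvPolynomial (Fin n) ℝ}
    {p : MvPolynomial (Fin n) ℝ} (hp : p ∈ quadModule g) :
    ∃ D : ℕ, ∀ d ≥ D, p ∈ truncQuadModule g d := by
  obtain ⟨s₀, hs₀, s, hs, rfl⟩ := hp
  refine ⟨s₀.totalDegree + ∑ j, ((s j).totalDegree + halfDeg (g j)), fun d hd =>
    ⟨s₀, ⟨hs₀, fun _ => ?_⟩, s, fun j => ⟨hs j, fun _ => ?_⟩, rfl⟩⟩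
  · omega
  · have := Finset.single_le_sum (f := fun j => (s j).totalDegree + halfDeg (g j))
      (fun _ _ => Nat.zero_le _) (Finset.mem_univ j)
    omega

/-- Polynomials that are positive on the feasible set of a boxed family lie in all truncated
quadratic modules of sufficiently large degree. -/
theorem exists_mem_truncQuadModule_of_pos {m : ℕ} (g : Fin m → MvPolynomial (Fin n) ℝ)
    {p : MvPolynomial (Fin n) ℝ} (hp : ∀ x ∈ feasibleSet (boxed g), 0 < eval x p) :
    ∃ D : ℕ, ∀ d ≥ D, p ∈ truncQuadModule (boxed g) d := by
  refine exists_mem_truncQuadModule ?_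
  have hM := isQuadraticModule_quadModule (boxed g)
  refine hM.mem_of_pos (hM.isArchimedeanSet fun i => ?_) fun x hx =>
    hp x fun j => hx _ (generator_mem_quadModule _ j)
  exact generator_mem_quadModule (boxed g) (Sum.inr i)

end Putinar

/-! ### Continuity in the coefficients and passage to the limit -/

section Limits

variable {n : ℕ}

instance finite_degree_le (d : ℕ) : Finite {α : Fin n →₀ ℕ // α.degree ≤ d} :=
  (Finsupp.finite_of_degree_le d).to_subtype

noncomputable instance fintype_degree_le (d : ℕ) : Fintype {α : Fin n →₀ ℕ // α.degree ≤ d} :=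
  Fintype.ofFinite _

theorem coeffVec_sub (d : ℕ) (p q : MvPolynomial (Fin n) ℝ) :
    coeffVec d (p - q) = coeffVec d p - coeffVec d q := by
  ext α
  simp [coeffVec]

theorem degree_le_of_mem_support {d : ℕ} {p : MvPolynomial (Fin n) ℝ}
    (hp : p ∈ restrictTotalDegree (Fin n) ℝ d) {α : Fin n →₀ ℕ} (hα : α ∈ p.support) :
    α.degree ≤ d := by
  rw [mem_restrictTotalDegree] at hp
  exact (le_totalDegree hα).trans hp

/-- Replaces the varying support by a fixed finite index set, which makes continuity in the
coefficient vector visible. -/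
theorem sum_support_eq {d : ℕ} {p : MvPolynomial (Fin n) ℝ}
    (hp : p ∈ restrictTotalDegree (Fin n) ℝ d) (F : (Fin n →₀ ℕ) → ℝ → ℝ)
    (hF : ∀ α, F α 0 = 0) :
    ∑ α ∈ p.support, F α (p.coeff α) =
      ∑ α : {α : Fin n →₀ ℕ // α.degree ≤ d}, F α (coeffVec d p α) := by
  refine (Finset.sum_bij_ne_zero (fun α _ _ => α.1) ?_ ?_ ?_ ?_).symm
  · intro α _ h
    rw [mem_support_iff]
    intro h0
    exact h (by rw [coeffVec, h0, hF])
  · intro α _ _ β _ _ h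
    exact Subtype.ext h
  · intro α hα h
    exact ⟨⟨α, degree_le_of_mem_support hp hα⟩, Finset.mem_univ _, h, rfl⟩
  · intro α _ _
    rfl

theorem exists_continuous_coeffNorm (k : NormIndex) (d : ℕ) :
    ∃ F : ({α : Fin n →₀ ℕ // α.degree ≤ d} → ℝ) → ℝ, Continuous F ∧
      ∀ p ∈ restrictTotalDegree (Fin n) ℝ d, coeffNorm k p = F (coeffVec d p) := by
  cases k with
  | one =>
    exact ⟨fun v => ∑ α, |v α|, by fun_prop,
      fun p hp => sum_support_eq hp (fun _ t => |t|) fun _ => abs_zero⟩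
  | two =>
    exact ⟨fun v => ∑ α, v α ^ 2, by fun_prop,
      fun p hp => sum_support_eq hp (fun _ t => t ^ 2) fun _ => by norm_num⟩
  | infty =>
    refine ⟨fun v => ‖v‖, continuous_norm, fun p hp => ?_⟩
    refine (NNReal.coe_inj.2 ?_).trans (Pi.norm_def _).symm
    apply le_antisymm
    · refine Finset.sup_le fun α hα => ?_
      exact Finset.le_sup (f := fun β => ‖coeffVec d p β‖₊)
        (Finset.mem_univ (⟨α, degree_le_of_mem_support hp hα⟩ :
          {α : Fin n →₀ ℕ // α.degree ≤ d}))
    · refine Finset.sup_le fun α _ => ?_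
      by_cases h : α.1 ∈ p.support
      · exact Finset.le_sup (f := fun β => ‖p.coeff β‖₊) h
      · rw [notMem_support_iff] at h
        simp [coeffVec, h]

theorem coeffNorm_nonneg (k : NormIndex) (p : MvPolynomial (Fin n) ℝ) : 0 ≤ coeffNorm k p := by
  cases k with
  | one => exact Finset.sum_nonneg fun _ _ => abs_nonneg _
  | two => exact Finset.sum_nonneg fun _ _ => sq_nonneg _
  | infty => exact NNReal.coe_nonneg _

theorem exists_continuous_eval (d : ℕ) (x : Fin n → ℝ) :
    ∃ F : ({α : Fin n →₀ ℕ // α.degree ≤ d} → ℝ) → ℝ, Continuous F ∧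
      ∀ p ∈ restrictTotalDegree (Fin n) ℝ d, eval x p = F (coeffVec d p) := by
  refine ⟨fun v => ∑ α, v α * ∏ i, x i ^ α.1 i, by fun_prop, fun p hp => ?_⟩
  rw [eval_eq']
  exact sum_support_eq hp (fun α t => t * ∏ i, x i ^ α i) fun _ => zero_mul _

theorem mem_idealFeasible_iff {K : Set (Fin n → ℝ)} {d : ℕ} {y : Fin n → ℝ} {ε : ℝ}
    {h : MvPolynomial (Fin n) ℝ} :
    h ∈ idealFeasible K d y ε ↔ h ∈ restrictTotalDegree (Fin n) ℝ d ∧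
      ∀ x ∈ K, 0 ≤ eval x h - eval y h + ε := by
  have hC : ∀ c : ℝ, C c ∈ restrictTotalDegree (Fin n) ℝ d := fun c => by
    simp [mem_restrictTotalDegree]
  simp only [idealFeasible, psdOn, Set.mem_ofPred_eq, map_add, map_sub, eval_C]
  constructor
  · rintro ⟨h₁, _, h₂⟩
    exact ⟨h₁, h₂⟩
  · rintro ⟨h₁, h₂⟩
    exact ⟨h₁, add_mem (sub_mem h₁ (hC _)) (hC _), h₂⟩

theorem idealFeasible_mono {K : Set (Fin n → ℝ)} {d : ℕ} {y : Fin n → ℝ} {ε δ : ℝ}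
    (h : ε ≤ δ) : idealFeasible K d y ε ⊆ idealFeasible K d y δ := by
  intro p hp
  rw [mem_idealFeasible_iff] at hp ⊢
  exact ⟨hp.1, fun x hx => by linarith [hp.2 x hx]⟩

theorem practicalFeasible_subset_idealFeasible {ι : Type} [Fintype ι]
    (g : ι → MvPolynomial (Fin n) ℝ) (d₀ d : ℕ) (ε : ℝ) :
    practicalFeasible g d₀ d ε ⊆ idealFeasible (feasibleSet g) d₀ 0 ε := by
  intro p hp
  refine mem_idealFeasible_iff.2 ⟨hp.1, fun x hx => ?_⟩
  simpa using eval_nonneg_of_mem_truncQuadModule hp.2 hx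

/-- Accumulation points of asymptotically feasible and asymptotically optimal sequences are
optimal solutions of the ideal inverse problem. -/
theorem isIdealOptimal_of_isAccPt {k : NormIndex} {K : Set (Fin n → ℝ)}
    {f : MvPolynomial (Fin n) ℝ} {y : Fin n → ℝ} {ε : ℕ → ℝ} (hε : Tendsto ε atTop (𝓝 0))
    {u : ℕ → MvPolynomial (Fin n) ℝ} (hu : ∀ l, u l ∈ idealFeasible K f.totalDegree y (ε l))
    {δ : ℕ → ℝ} (hδ : Tendsto δ atTop (𝓝 0))
    (hopt : ∀ l, ∀ p ∈ idealFeasible K f.totalDegree y 0,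
      coeffNorm k (u l - f) ≤ coeffNorm k (p - f) + δ l)
    {h : MvPolynomial (Fin n) ℝ} (hh : IsAccPt f.totalDegree u h) :
    IsIdealOptimal k K f y 0 h := by
  obtain ⟨hdeg, hcl⟩ := hh
  obtain ⟨φ, hφ, hlim⟩ := hcl.tendsto_subseq
  have hudeg : ∀ l, u l ∈ restrictTotalDegree (Fin n) ℝ f.totalDegree := fun l => (hu l).1
  have hfdeg : f ∈ restrictTotalDegree (Fin n) ℝ f.totalDegree := by
    rw [mem_restrictTotalDegree]
  have heval : ∀ x, Tendsto (fun l => eval x (u (φ l))) atTop (𝓝 (eval x h)) := by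
    intro x
    obtain ⟨F, hF, hFe⟩ := exists_continuous_eval f.totalDegree x
    rw [hFe h hdeg]
    simp only [hFe _ (hudeg _)]
    exact (hF.tendsto _).comp hlim
  refine ⟨mem_idealFeasible_iff.2 ⟨hdeg, fun x hx => ?_⟩, fun p hp => ?_⟩
  · exact ge_of_tendsto' (((heval x).sub (heval y)).add (hε.comp hφ.tendsto_atTop))
      fun l => (mem_idealFeasible_iff.1 (hu (φ l))).2 x hx
  · have hnorm : Tendsto (fun l => coeffNorm k (u (φ l) - f)) atTop (𝓝 (coeffNorm k (h - f))) := by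
      obtain ⟨F, hF, hFe⟩ := exists_continuous_coeffNorm (n := n) k f.totalDegree
      rw [hFe _ (sub_mem hdeg hfdeg)]
      simp only [hFe _ (sub_mem (hudeg _) hfdeg), coeffVec_sub]
      exact (hF.tendsto _).comp (hlim.sub_const _)
    have hbound : Tendsto (fun l => coeffNorm k (p - f) + δ (φ l)) atTop
        (𝓝 (coeffNorm k (p - f) + 0)) := (hδ.comp hφ.tendsto_atTop).const_add _
    simpa using le_of_tendsto_of_tendsto' hnorm hbound fun l => hopt (φ l) p hp

/-- A near-minimizer suffices, so attainment of the ideal minimum is never needed. -/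
theorem exists_nearly_nearest (k : NormIndex) (f : MvPolynomial (Fin n) ℝ)
    {S : Set (MvPolynomial (Fin n) ℝ)} (hS : S.Nonempty) {ε : ℝ} (hε : 0 < ε) :
    ∃ p ∈ S, ∀ q ∈ S, coeffNorm k (p - f) ≤ coeffNorm k (q - f) + ε := by
  have hbdd : BddBelow ((fun p => coeffNorm k (p - f)) '' S) := by
    refine ⟨0, ?_⟩
    rintro _ ⟨p, _, rfl⟩
    exact coeffNorm_nonneg _ _
  obtain ⟨_, ⟨p, hp, rfl⟩, hlt⟩ := exists_lt_of_csInf_lt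
    (hS.image fun p => coeffNorm k (p - f)) (lt_add_of_pos_right _ hε)
  exact ⟨p, hp, fun q hq => hlt.le.trans
    (add_le_add_left (csInf_le hbdd (Set.mem_image_of_mem _ hq)) _)⟩

/-- For every `ε > 0` some nearly optimal solution of the ideal inverse problem is feasible for all
practical problems with sufficiently large degree bound. -/
theorem exists_degree_bound {m : ℕ} (k : NormIndex) (g : Fin m → MvPolynomial (Fin n) ℝ)
    (f : MvPolynomial (Fin n) ℝ) {ε : ℝ} (hε : 0 < ε) :
    ∃ D : ℕ, ∀ d ≥ D, ∃ p ∈ practicalFeasible (boxed g) f.totalDegree d ε,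
      ∀ q ∈ idealFeasible (feasibleSet (boxed g)) f.totalDegree 0 0,
        coeffNorm k (p - f) ≤ coeffNorm k (q - f) + ε := by
  obtain ⟨p, hp, hpq⟩ := exists_nearly_nearest k f
    (S := idealFeasible (feasibleSet (boxed g)) f.totalDegree 0 0)
    ⟨0, mem_idealFeasible_iff.2 ⟨zero_mem _, by simp⟩⟩ hε
  obtain ⟨hdeg, hpos⟩ := mem_idealFeasible_iff.1 hp
  -- On the feasible set this polynomial is at least `ε`, hence strictly positive.
  obtain ⟨D, hD⟩ := exists_mem_truncQuadModule_of_pos g (p := p - C (eval 0 p) + C ε)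
    fun x hx => by
      have := hpos x hx
      simp only [map_add, map_sub, eval_C]
      linarith
  exact ⟨D, fun d hd => ⟨p, ⟨hdeg, hD d hd⟩, hpq⟩⟩

end Limits

end InversePoly

theorem proposition4p5 {n m : ℕ} (k : InversePoly.NormIndex)
    (g : Fin m → MvPolynomial (Fin n) ℝ) (f : MvPolynomial (Fin n) ℝ)
    (K : Set (Fin n → ℝ)) (hK : K = InversePoly.feasibleSet (InversePoly.boxed g))
    (hint : (interior K).Nonempty) (h0 : (0 : Fin n → ℝ) ∈ K) :
    (∀ ε : ℕ → ℝ, (∀ l, 0 < ε l) → Tendsto ε atTop (𝓝 0) →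
      ∀ u : ℕ → MvPolynomial (Fin n) ℝ,
        (∀ l, InversePoly.IsIdealOptimal k K f 0 (ε l) (u l)) →
        ∀ h : MvPolynomial (Fin n) ℝ, InversePoly.IsAccPt f.totalDegree u h →
          InversePoly.IsIdealOptimal k K f 0 0 h) ∧
    (∃ D : ℝ → ℕ, ∀ ε : ℕ → ℝ, (∀ l, 0 < ε l) → Tendsto ε atTop (𝓝 0) →
      ∀ d : ℕ → ℕ, (∀ l, D (ε l) ≤ d l) →
      ∀ u : ℕ → MvPolynomial (Fin n) ℝ,
        (∀ l, InversePoly.IsPracticalOptimal k (InversePoly.boxed g) f (d l) (ε l) (u l)) →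
        ∀ h : MvPolynomial (Fin n) ℝ, InversePoly.IsAccPt f.totalDegree u h →
          InversePoly.IsIdealOptimal k K f 0 0 h) := by
  subst hK
  constructor
  · intro ε hpos hε u hu h hh
    refine InversePoly.isIdealOptimal_of_isAccPt hε (fun l => (hu l).1) tendsto_const_nhds
      (fun l p hp => ?_) hh
    simpa using (hu l).2 p (InversePoly.idealFeasible_mono (hpos l).le hp)
  -- The values of `D` at `ε ≤ 0` are irrelevant.
  · choose! D hD using fun (ε : ℝ) (hε : 0 < ε) => InversePoly.exists_degree_bound k g f hε
    refine ⟨D, fun ε hpos hε d hd u hu h hh => ?_⟩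
    refine InversePoly.isIdealOptimal_of_isAccPt hε
      (fun l => InversePoly.practicalFeasible_subset_idealFeasible _ _ _ _ (hu l).1) hε
      (fun l q hq => ?_) hh
    obtain ⟨p, hp, hpq⟩ := hD (ε l) (hpos l) (d l) (hd l)
    exact ((hu l).2 p hp).trans (hpq q hq)
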